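/- Consider first-order logic $\mathsf{FO}$ with equality and without constant and function symbols, with formulas $\varphi ::= \top \mid P(x_1,\dots,x_n)\mid x_1=x_2\mid \varphi\wedge\varphi'\mid\neg\varphi\mid\exists x\,\varphi$, over countably many individual variables and countably many predicate symbols $P$ of each arity $n\ge 0$; structures have nonempty domains. Write $\varphi\models\psi$ if, for every structure and every assignment in it, truth of $\varphi$ implies truth of $\psi$. An $\mathsf{FO}$-fragment is a set $\mathsf F$ of $\mathsf{FO}$-formulas; it is called decidable if there is an algorithm that, given $\varphi,\psi\in\mathsf F$, decides whether $\varphi\models\psi$ (if $\mathsf F$ is closed under $\wedge$ and $\neg$, this amounts to deciding validity of $\mathsf F$-formulas). Formulas of propositional modal logic $\mathsf{ML}$, $\chi ::= \top\mid p\mid\chi\wedge\chi'\mid\neg\chi\mid\Diamond\chi$ (with countably many propositional variables $p$), are regarded as $\mathsf{FO}$-formulas by means of the standard translation with two distinct individual variables $x,y$, a binary predicate symbol $R$ and a unary predicate symbol $p$ for each propositional variable $p$: $\top^*_x=(x=x)$, $p^*_x=p(x)$, $(\chi\wedge\chi')^*_x=\chi^*_x\wedge\chi'^*_x$, $(\neg\chi)^*_x=\neg\chi^*_x$,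 $(\Diamond\chi)^*_x=\exists y\,(R(x,y)\wedge\chi^*_y)$, and likewise for $\chi^*_y$ with $x$ and $y$ swapped. A fragment $\mathsf F$ contains $\mathsf{ML}$ if $\chi^*_x\in\mathsf F$ for every $\mathsf{ML}$-formula $\chi$. Theorem. For any decidable $\mathsf{FO}$-fragment $\mathsf F$ containing $\mathsf{ML}$, $\mathsf F/\mathsf{ML}$-definability is decidable: there is an algorithm that, given a formula $\varphi\in\mathsf F$, decides whether there exists an $\mathsf{ML}$-formula $\chi$ such that $\varphi\models\chi^*_x$ and $\chi^*_x\models\varphi$. -/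

import Mathlib

namespace ModalDefinability

/-! ## First-order logic with equality, without constants and function symbols

Individual variables are natural numbers.  For every arity `n` there are countably many predicate
symbols of arity `n`; the symbol with index `i` and arity `n` is the pair `(i, n)`. -/

/-- First-order formulas.  `rel i [x₁, …, xₙ]` is the atom `P(x₁, …, xₙ)`, where `P` is the
predicate symbol with index `i` and arity `n`. -/
inductive FO : Type
  | top : FO
  | rel (i : ℕ) (args : List ℕ) : FO
  | eq (x y : ℕ) : FO
  | and (φ ψ : FO) : FO
  | not (φ : FO) : FO
  | ex (x : ℕ) (φ : FO) : FO

/-- A relational structure: a nonempty domain and an `n`-ary relation on it for every predicate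
symbol `(i, n)`. -/
structure Struc : Type 1 where
  dom : Type
  nonempty : Nonempty dom
  rel : (i n : ℕ) → (Fin n → dom) → Prop

/-- `φ.Sat A v`: the formula `φ` is true in `A` under the assignment `v`. -/
def FO.Sat (A : Struc) : FO → (ℕ → A.dom) → Prop
  | .top, _ => True
  | .rel i args, v => A.rel i args.length (fun k => v (args.get k))
  | .eq x y, v => v x = v y
  | .and φ ψ, v => φ.Sat A v ∧ ψ.Sat A v
  | .not φ, v => ¬ φ.Sat A v
  | .ex x φ, v => ∃ a : A.dom, φ.Sat A (Function.update v x a)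

/-- Entailment `φ ⊨ ψ`. -/
def FO.Entails (φ ψ : FO) : Prop :=
  ∀ (A : Struc) (v : ℕ → A.dom), φ.Sat A v → ψ.Sat A v

/-! ## Propositional modal logic and its standard translation -/

/-- Formulas of propositional modal logic with one possibility operator `dia`; `var i` is the
`i`-th propositional variable. -/
inductive ML : Type
  | top : ML
  | var (i : ℕ) : ML
  | and (φ ψ : ML) : ML
  | not (φ : ML) : ML
  | dia (φ : ML) : ML

/-- The standard translation of a modal formula, with the free variable `x`, using the two
individual variables `x` and `y`.  The accessibility relation is the binary predicate symbol with
index `0`, and the propositional variable `var i` is the unary predicate symbol with index `i`. -/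
def ML.st : ML → ℕ → ℕ → FO
  | .top, x, _ => .eq x x
  | .var i, x, _ => .rel i [x]
  | .and φ ψ, x, y => .and (φ.st x y) (ψ.st x y)
  | .not φ, x, y => .not (φ.st x y)
  | .dia φ, x, y => .ex y (.and (.rel 0 [x, y]) (φ.st y x))

/-- The set of first-order formulas `F` contains modal logic (written with the variables `x`
and `y`): it contains the standard translation of every modal formula. -/
def ContainsML (F : Set FO) (x y : ℕ) : Prop :=
  ∀ χ : ML, χ.st x y ∈ F

/-- The formula `φ` is definable by a modal formula (evaluated at `x`): there is a modal formula
`χ` with `φ ⊨ χ` and `χ ⊨ φ`. -/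
def MLDefinable (x y : ℕ) (φ : FO) : Prop :=
  ∃ χ : ML, φ.Entails (χ.st x y) ∧ (χ.st x y).Entails φ

/-! ## Formulas as inputs of algorithms -/

/-- A Gödel numbering of the first-order formulas. -/
def FO.encodeFO : FO → ℕ
  | .top => 0
  | .rel i args => 5 * Nat.pair i (Encodable.encode args) + 1
  | .eq x y => 5 * Nat.pair x y + 2
  | .and φ ψ => 5 * Nat.pair φ.encodeFO ψ.encodeFO + 3
  | .not φ => 5 * φ.encodeFO + 4
  | .ex x φ => 5 * Nat.pair x φ.encodeFO + 5

/-- The inverse of the Gödel numbering. -/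
def FO.ofNatFO : ℕ → FO
  | 0 => .top
  | n + 1 =>
    let m := n / 5
    have hm : m < n + 1 := Nat.lt_succ_of_le (Nat.div_le_self n 5)
    have _h1 : m.unpair.1 < n + 1 := lt_of_le_of_lt m.unpair_left_le hm
    have _h2 : m.unpair.2 < n + 1 := lt_of_le_of_lt m.unpair_right_le hm
    match n % 5 with
    | 0 => .rel m.unpair.1 (Denumerable.ofNat (List ℕ) m.unpair.2)
    | 1 => .eq m.unpair.1 m.unpair.2
    | 2 => .and (FO.ofNatFO m.unpair.1) (FO.ofNatFO m.unpair.2)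
    | 3 => .not (FO.ofNatFO m)
    | _ => .ex m.unpair.1 (FO.ofNatFO m.unpair.2)
  termination_by n => n
  decreasing_by all_goals assumption

theorem FO.ofNatFO_encodeFO (φ : FO) : FO.ofNatFO φ.encodeFO = φ := by
  induction φ with
  | top => simp [FO.encodeFO, FO.ofNatFO]
  | rel i args =>
    rw [FO.encodeFO, FO.ofNatFO]
    simp
  | eq x y =>
    rw [FO.encodeFO, FO.ofNatFO]
    simp [Nat.add_mod, Nat.add_div]
  | and φ ψ h1 h2 =>
    rw [FO.encodeFO, FO.ofNatFO]
    simp [Nat.add_mod, Nat.add_div, h1, h2]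
  | not φ h =>
    rw [FO.encodeFO, FO.ofNatFO]
    simp [Nat.add_mod, Nat.add_div, h]
  | ex x φ h =>
    rw [FO.encodeFO, FO.ofNatFO]
    simp [Nat.add_mod, Nat.add_div, h]

theorem FO.encodeFO_ofNatFO (n : ℕ) : (FO.ofNatFO n).encodeFO = n := by
  induction n using Nat.strong_induction_on with
  | _ n ih =>
    cases n with
    | zero => simp [FO.ofNatFO, FO.encodeFO]
    | succ n =>
      have hm : n / 5 < n + 1 := Nat.lt_succ_of_le (Nat.div_le_self n 5)
      have e0 := ih _ hm
      have e1 := ih _ (lt_of_le_of_lt (n / 5).unpair_left_le hm)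
      have e2 := ih _ (lt_of_le_of_lt (n / 5).unpair_right_le hm)
      have hd := Nat.div_add_mod n 5
      have hr : n % 5 < 5 := Nat.mod_lt _ (by norm_num)
      rw [FO.ofNatFO]
      generalize n % 5 = r at hd hr
      interval_cases r <;> simp [FO.encodeFO, e0, e1, e2] <;> omega

instance : Denumerable FO :=
  Denumerable.mk' ⟨FO.encodeFO, FO.ofNatFO, FO.ofNatFO_encodeFO, FO.encodeFO_ofNatFO⟩

/-- The decision problem with the set of inputs `S` and the question `P` is decidable: there is an
algorithm that halts on every input `a ∈ S` and answers correctly whether `P a` holds.  (On other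
inputs the algorithm may do anything.) -/
def DecidableOn {α : Type} [Primcodable α] (S : Set α) (P : α → Prop) : Prop :=
  ∃ f : α →. Bool, Partrec f ∧ ∀ a ∈ S, ∃ b ∈ f a, (b = true ↔ P a)

/-- The fragment `F` of first-order logic is decidable: it is decidable whether `φ ⊨ ψ`, for
given formulas `φ, ψ ∈ F`. -/
def DecidableFragment (F : Set FO) : Prop :=
  DecidableOn (F ×ˢ F) (fun p : FO × FO => p.1.Entails p.2)

end ModalDefinability

namespace ModalDefinability

/-! ## Quantifier rank, modal depth, and reducts -/

/-! A definable `φ` of quantifier rank at most `q`, with unary predicates of index below `k`, has a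
modal definition of depth at most N, where N = `depthBound k q` is computable. Up to equivalence
there are finitely many modal formulas of depth at most N over `k` variables, and a list of
representatives is computable. Since `F` contains their translations, its decision procedure tests
each of them for equivalence with `φ`.

The bound is the core (`ML.sat_iff_of_nBisim`). Consider the set of pairs of rank-`q` types realized
by `n`-bisimilar pointed structures, after each structure has been replaced by one that is
`m`-bisimilar to it for every `m`. It is enough to use structures built by placing a root above a
disjoint union. The type of such a structure depends only on the label of the root and the types of
the components (`ptp_root`, a composition argument with Ehrenfeucht–Fraïssé games). Hence the set
for `n + 1` is a monotone operator applied to the set for `n`. The sets decrease inside a finite set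
with N elements, so they are constant from N on. Thus N-bisimilar structures can be traded, without
changing the types of their replacements, for structures that are bisimilar to the depth of any
given modal `χ`. If `χ` is equivalent to `φ`, equality of types preserves its truth, so
N-bisimilarity preserves it too. -/

/-- Quantifier rank. -/
def FO.qr : FO → ℕ
  | .top => 0
  | .rel _ _ => 0
  | .eq _ _ => 0
  | .and φ ψ => max φ.qr ψ.qr
  | .not φ => φ.qr
  | .ex _ φ => φ.qr + 1

/-- All unary predicate symbols of the formula have indices in `K`. -/
def FO.UnaryIn (K : ℕ → Prop) : FO → Prop
  | .top => True
  | .rel i args => args.length = 1 → K i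
  | .eq _ _ => True
  | .and φ ψ => φ.UnaryIn K ∧ ψ.UnaryIn K
  | .not φ => φ.UnaryIn K
  | .ex _ φ => φ.UnaryIn K

/-- Modal depth. -/
def ML.depth : ML → ℕ
  | .top => 0
  | .var _ => 0
  | .and φ ψ => max φ.depth ψ.depth
  | .not φ => φ.depth
  | .dia φ => φ.depth + 1

/-- The accessibility relation of a structure. -/
def Struc.acc (A : Struc) (a b : A.dom) : Prop := A.rel 0 2 ![a, b]

/-- The valuation of the propositional variables in a structure. -/
def Struc.val (A : Struc) (i : ℕ) (a : A.dom) : Prop := A.rel i 1 ![a]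

/-- Truth of a modal formula at a point of a structure. -/
def ML.Sat (A : Struc) : ML → A.dom → Prop
  | .top, _ => True
  | .var i, a => A.val i a
  | .and φ ψ, a => φ.Sat A a ∧ ψ.Sat A a
  | .not φ, a => ¬ φ.Sat A a
  | .dia φ, a => ∃ b, A.acc a b ∧ φ.Sat A b

theorem ML.sat_st (A : Struc) (χ : ML) {x y : ℕ} (hxy : x ≠ y) (v : ℕ → A.dom) :
    (χ.st x y).Sat A v ↔ χ.Sat A (v x) := by
  induction χ generalizing x y v with
  | top => simp [ML.st, FO.Sat, ML.Sat]
  | var i =>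
    have : (fun k : Fin 1 => v ([x].get k)) = ![v x] := by
      funext k; fin_cases k; rfl
    simp only [ML.st, FO.Sat, ML.Sat, Struc.val]
    exact iff_of_eq (congrArg (A.rel i 1) this)
  | and φ ψ h1 h2 => simp [ML.st, FO.Sat, ML.Sat, h1 hxy, h2 hxy]
  | not φ h => simp [ML.st, FO.Sat, ML.Sat, h hxy]
  | dia φ h =>
    simp only [ML.st, FO.Sat, ML.Sat, Struc.acc, h hxy.symm]
    refine exists_congr fun b => and_congr (iff_of_eq (congrArg (A.rel 0 2) ?_)) (by simp)
    funext k; fin_cases k <;> simp [hxy]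

/-- The reduct of a structure to the accessibility relation and the unary predicates in `K`; all
other predicates become empty. -/
def Struc.red (K : ℕ → Prop) (A : Struc) : Struc where
  dom := A.dom
  nonempty := A.nonempty
  rel i n a := (i = 0 ∧ n = 2 ∨ n = 1 ∧ K i) ∧ A.rel i n a

theorem ML.sat_red_univ (A : Struc) (χ : ML) (a : A.dom) :
    χ.Sat (A.red fun _ => True) a ↔ χ.Sat A a := by
  induction χ generalizing a with
  | top => simp [ML.Sat]
  | var i => simp [ML.Sat, Struc.val, Struc.red]
  | and φ ψ h1 h2 => simp only [ML.Sat, h1, h2]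
  | not φ h => simp only [ML.Sat, h]
  | dia φ h =>
    refine exists_congr fun b => and_congr ?_ (h b)
    simp [Struc.acc, Struc.red]

/-- The two reducts differ only in unary predicates outside `K`, which `φ` does not mention. Symbols
of other arities may occur in `φ`, but both reducts treat them alike. -/
theorem FO.sat_red_univ {K : ℕ → Prop} (A : Struc) (φ : FO) (hφ : φ.UnaryIn K)
    (v : ℕ → A.dom) : φ.Sat (A.red fun _ => True) v ↔ φ.Sat (A.red K) v := by
  induction φ generalizing v with
  | top => simp [FO.Sat]
  | rel i args =>
    simp only [FO.UnaryIn] at hφ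
    simp only [FO.Sat, Struc.red, and_true]
    constructor <;> rintro ⟨h1 | h1, h2⟩
    · exact ⟨Or.inl h1, h2⟩
    · exact ⟨Or.inr ⟨h1, hφ h1⟩, h2⟩
    · exact ⟨Or.inl h1, h2⟩
    · exact ⟨Or.inr h1.1, h2⟩
  | eq x y => exact Iff.rfl
  | and φ ψ h1 h2 => exact and_congr (h1 hφ.1 v) (h2 hφ.2 v)
  | not φ h => exact not_congr (h hφ v)
  | ex x φ h => exact exists_congr fun b => h hφ _

/-! ## Bounded bisimilarity -/

/-- `n`-bisimilarity with respect to the propositional variables with index below `k`. -/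
def NBisim (k : ℕ) : ℕ → (A : Struc) → A.dom → (B : Struc) → B.dom → Prop
  | 0, A, a, B, b => ∀ i < k, A.val i a ↔ B.val i b
  | n + 1, A, a, B, b => (∀ i < k, A.val i a ↔ B.val i b) ∧
      (∀ a', A.acc a a' → ∃ b', B.acc b b' ∧ NBisim k n A a' B b') ∧
      (∀ b', B.acc b b' → ∃ a', A.acc a a' ∧ NBisim k n A a' B b')

theorem NBisim.val {k n : ℕ} {A B : Struc} {a : A.dom} {b : B.dom} (h : NBisim k n A a B b) :
    ∀ i < k, A.val i a ↔ B.val i b := by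
  cases n with
  | zero => exact h
  | succ n => exact h.1

theorem NBisim.refl (k n : ℕ) (A : Struc) (a : A.dom) : NBisim k n A a A a := by
  induction n generalizing a with
  | zero => exact fun i _ => Iff.rfl
  | succ n ih => exact ⟨fun i _ => Iff.rfl, fun a' h => ⟨a', h, ih a'⟩, fun a' h => ⟨a', h, ih a'⟩⟩

theorem NBisim.symm {k n : ℕ} {A B : Struc} {a : A.dom} {b : B.dom} (h : NBisim k n A a B b) :
    NBisim k n B b A a := by
  induction n generalizing a b with
  | zero => exact fun i hi => (h i hi).symm
  | succ n ih =>
    refine ⟨fun i hi => (h.1 i hi).symm, fun b' hb => ?_, fun a' ha => ?_⟩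
    · obtain ⟨a', h1, h2⟩ := h.2.2 b' hb
      exact ⟨a', h1, ih h2⟩
    · obtain ⟨b', h1, h2⟩ := h.2.1 a' ha
      exact ⟨b', h1, ih h2⟩

theorem NBisim.trans {k n : ℕ} {A B C : Struc} {a : A.dom} {b : B.dom} {c : C.dom}
    (h : NBisim k n A a B b) (h' : NBisim k n B b C c) : NBisim k n A a C c := by
  induction n generalizing a b c with
  | zero => exact fun i hi => (h i hi).trans (h' i hi)
  | succ n ih =>
    refine ⟨fun i hi => (h.1 i hi).trans (h'.1 i hi), fun a' ha => ?_, fun c' hc => ?_⟩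
    · obtain ⟨b', h1, h2⟩ := h.2.1 a' ha
      obtain ⟨c', h3, h4⟩ := h'.2.1 b' h1
      exact ⟨c', h3, ih h2 h4⟩
    · obtain ⟨b', h1, h2⟩ := h'.2.2 c' hc
      obtain ⟨a', h3, h4⟩ := h.2.2 b' h1
      exact ⟨a', h3, ih h4 h2⟩

/-- In the reducts all variables of index at least `k` are false everywhere, so `χ` may contain
them. -/
theorem NBisim.sat_iff {k n : ℕ} {A B : Struc} {a : A.dom} {b : B.dom}
    (h : NBisim k n A a B b) (χ : ML) (hχ : χ.depth ≤ n) :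
    χ.Sat (A.red (· < k)) a ↔ χ.Sat (B.red (· < k)) b := by
  induction χ generalizing n a b with
  | top => exact Iff.rfl
  | var i =>
    have := h.val i
    simp only [Struc.val] at this
    simp only [ML.Sat, Struc.val, Struc.red]
    by_cases hi : i < k
    · simp [hi, this]
    · simp [hi]
  | and φ ψ h1 h2 =>
    simp only [ML.depth, max_le_iff] at hχ
    exact and_congr (h1 h hχ.1) (h2 h hχ.2)
  | not φ ih => exact not_congr (ih h hχ)
  | dia φ ih =>
    simp only [ML.depth] at hχ
    obtain ⟨n, rfl⟩ : ∃ m, n = m + 1 := ⟨n - 1, by omega⟩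
    have hd : φ.depth ≤ n := by omega
    have hacc : ∀ (C : Struc) (c d : C.dom), (C.red (· < k)).acc c d ↔ C.acc c d := fun C c d => by
      simp [Struc.acc, Struc.red]
    constructor
    · rintro ⟨a', h1, h2⟩
      obtain ⟨b', h3, h4⟩ := h.2.1 a' ((hacc _ _ _).1 h1)
      exact ⟨b', (hacc _ _ _).2 h3, (ih h4 hd).1 h2⟩
    · rintro ⟨b', h1, h2⟩
      obtain ⟨a', h3, h4⟩ := h.2.2 b' ((hacc _ _ _).1 h1)
      exact ⟨a', (hacc _ _ _).2 h3, (ih h4 hd).2 h2⟩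

/-! ## First-order types of bounded quantifier rank -/

/-- The finite set of all possible types of quantifier rank `q` of `m`-tuples, over the accessibility
relation and `k` unary predicates. -/
def Ty (k : ℕ) : ℕ → ℕ → Type
  | 0, m => (Fin m → Fin m → Prop) × (Fin m → Fin m → Prop) × (Fin k → Fin m → Prop)
  | q + 1, m => Set (Ty k q (m + 1))

/-- The number of elements of `Ty k q m`. -/
def tyCard (k q m : ℕ) : ℕ :=
  -- After `q` rounds the tuple has length `m + q`; its atomic type consists of two binary tables
  -- and `k` unary ones. Each round takes one power set.
  (fun n => 2 ^ n)^[q] (2 ^ ((m + q) * (m + q) + (m + q) * (m + q) + k * (m + q)))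

instance Ty.instFinite (k q m : ℕ) : Finite (Ty k q m) := by
  induction q generalizing m with
  | zero => unfold Ty; infer_instance
  | succ q ih => have := ih (m + 1); unfold Ty; infer_instance

theorem natCard_set (α : Type) [Finite α] : Nat.card (Set α) = 2 ^ Nat.card α := by
  classical
  have := Fintype.ofFinite α
  rw [Nat.card_eq_fintype_card, Nat.card_eq_fintype_card, Fintype.card_set]

theorem card_ty (k q m : ℕ) : Nat.card (Ty k q m) = tyCard k q m := by
  induction q generalizing m with
  | zero =>
    have h2 : Nat.card Prop = 2 := by simp
    simp only [Ty, Nat.card_prod, Nat.card_fun, Nat.card_fin, h2, tyCard, Function.iterate_zero, id]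
    simp only [← pow_mul, ← pow_add, Nat.add_zero]
    congr 1; ring
  | succ q ih =>
    have : Nat.card (Ty k (q + 1) m) = 2 ^ Nat.card (Ty k q (m + 1)) := natCard_set _
    rw [this, ih, tyCard, tyCard, Function.iterate_succ_apply', show m + 1 + q = m + (q + 1) by ring]

/-- The type of quantifier rank `q` of a tuple. -/
def tp (k : ℕ) : (q : ℕ) → (A : Struc) → {m : ℕ} → (Fin m → A.dom) → Ty k q m
  | 0, A, _, u => (fun i j => u i = u j, fun i j => A.acc (u i) (u j), fun i j => A.val i (u j))
  | q + 1, A, m, u => Set.range fun a : A.dom => (tp k q A (Fin.cons a u : Fin (m + 1) → A.dom))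

theorem tp_zero_iff {k m : ℕ} {A B : Struc} {u : Fin m → A.dom} {w : Fin m → B.dom} :
    tp k 0 A u = tp k 0 B w ↔ (∀ i j, u i = u j ↔ w i = w j) ∧
      (∀ i j, A.acc (u i) (u j) ↔ B.acc (w i) (w j)) ∧
      (∀ i < k, ∀ j, A.val i (u j) ↔ B.val i (w j)) := by
  refine Prod.ext_iff.trans (and_congr ?_ (Prod.ext_iff.trans (and_congr ?_ ?_)))
  · simp only [tp, funext_iff, eq_iff_iff]
  · simp only [tp, funext_iff, eq_iff_iff]
  · simp only [tp, funext_iff, eq_iff_iff]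
    exact ⟨fun h i hi => h ⟨i, hi⟩, fun h i => h i i.2⟩

theorem tp_succ_iff {k q m : ℕ} {A B : Struc} {u : Fin m → A.dom} {w : Fin m → B.dom} :
    tp k (q + 1) A u = tp k (q + 1) B w ↔
      (∀ a, ∃ b, tp k q A (Fin.cons a u : Fin (m + 1) → A.dom) =
        tp k q B (Fin.cons b w : Fin (m + 1) → B.dom)) ∧
      (∀ b, ∃ a, tp k q A (Fin.cons a u : Fin (m + 1) → A.dom) =
        tp k q B (Fin.cons b w : Fin (m + 1) → B.dom)) := by
  constructor
  · intro h
    have h' : Set.range (fun a : A.dom => tp k q A (Fin.cons a u : Fin (m + 1) → A.dom)) =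
      Set.range (fun b : B.dom => tp k q B (Fin.cons b w : Fin (m + 1) → B.dom)) := h
    refine ⟨fun a => ?_, fun b => ?_⟩
    · obtain ⟨b, hb⟩ := h'.subset ⟨a, rfl⟩
      exact ⟨b, hb.symm⟩
    · obtain ⟨a, ha⟩ := h'.symm.subset ⟨b, rfl⟩
      exact ⟨a, ha⟩
  · rintro ⟨h1, h2⟩
    refine Set.Subset.antisymm ?_ ?_
    · rintro _ ⟨a, rfl⟩
      obtain ⟨b, hb⟩ := h1 a
      exact ⟨b, hb.symm⟩
    · rintro _ ⟨b, rfl⟩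
      obtain ⟨a, ha⟩ := h2 b
      exact ⟨a, ha⟩

/-- Domains are nonempty, so the remaining rounds can be played with arbitrary elements that are
then forgotten. -/
theorem tp_zero_of_tp {k q m : ℕ} {A B : Struc} {u : Fin m → A.dom} {w : Fin m → B.dom}
    (h : tp k q A u = tp k q B w) : tp k 0 A u = tp k 0 B w := by
  induction q generalizing m with
  | zero => exact h
  | succ q ih =>
    obtain ⟨a⟩ := A.nonempty
    obtain ⟨b, hb⟩ := (tp_succ_iff.1 h).1 a
    obtain ⟨h1, h2, h3⟩ := tp_zero_iff.1 (ih hb)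
    exact tp_zero_iff.2 ⟨fun i j => by simpa using h1 i.succ j.succ,
      fun i j => by simpa using h2 i.succ j.succ, fun i hi j => by simpa using h3 i hi j.succ⟩

/-- Atomic types record equality, so the only correct answer to a repeated element is the
corresponding repetition. -/
theorem tp_cons_coord {k q m : ℕ} {A B : Struc} {u : Fin m → A.dom} {w : Fin m → B.dom}
    (h : tp k (q + 1) A u = tp k (q + 1) B w) (j : Fin m) :
    tp k q A (Fin.cons (u j) u : Fin (m + 1) → A.dom) =
      tp k q B (Fin.cons (w j) w : Fin (m + 1) → B.dom) := by
  obtain ⟨b, hb⟩ := (tp_succ_iff.1 h).1 (u j)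
  have := (tp_zero_iff.1 (tp_zero_of_tp hb)).1 0 j.succ
  simp only [Fin.cons_zero, Fin.cons_succ, true_iff] at this
  rwa [this] at hb

theorem FO.sat_iff_of_tp {k q m : ℕ} {A B : Struc} {u : Fin m → A.dom} {w : Fin m → B.dom}
    (h : tp k q A u = tp k q B w) (φ : FO) (hφ : φ.qr ≤ q) (ρ : ℕ → Fin m) :
    φ.Sat (A.red (· < k)) (u ∘ ρ) ↔ φ.Sat (B.red (· < k)) (w ∘ ρ) := by
  induction φ generalizing q m with
  | top => exact Iff.rfl
  | rel i args =>
    obtain ⟨-, h2, h3⟩ := tp_zero_iff.1 (tp_zero_of_tp h)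
    match args with
    | [] => simp [FO.Sat, Struc.red]
    | [x] =>
      have e : ∀ (C : Struc) (f : ℕ → C.dom), (fun j : Fin [x].length => f ([x].get j)) = ![f x] := by
        intro C f; funext j; fin_cases j; rfl
      simp only [FO.Sat]
      erw [e (A.red (· < k)) (u ∘ ρ), e (B.red (· < k)) (w ∘ ρ)]
      by_cases hi : i < k
      · simpa [Struc.red, hi, Struc.val] using h3 i hi (ρ x)
      · simp [Struc.red, hi]
    | [x, y] =>
      have e : ∀ (C : Struc) (f : ℕ → C.dom),
          (fun j : Fin [x, y].length => f ([x, y].get j)) = ![f x, f y] := by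
        intro C f; funext j; fin_cases j <;> rfl
      simp only [FO.Sat]
      erw [e (A.red (· < k)) (u ∘ ρ), e (B.red (· < k)) (w ∘ ρ)]
      by_cases hi : i = 0
      · subst hi
        simpa [Struc.red, Struc.acc] using h2 (ρ x) (ρ y)
      · simp [Struc.red, hi]
    | _ :: _ :: _ :: _ => simp [FO.Sat, Struc.red]
  | eq x y => exact (tp_zero_iff.1 (tp_zero_of_tp h)).1 (ρ x) (ρ y)
  | and φ ψ h1 h2 =>
    simp only [FO.qr, max_le_iff] at hφ
    exact and_congr (h1 h hφ.1 ρ) (h2 h hφ.2 ρ)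
  | not φ ih => exact not_congr (ih h hφ ρ)
  | ex x φ ih =>
    simp only [FO.qr] at hφ
    obtain ⟨q, rfl⟩ : ∃ r, q = r + 1 := ⟨q - 1, by omega⟩
    have hd : φ.qr ≤ q := by omega
    -- The quantified variable is redirected to the new position `0` and the others are shifted; the
    -- old value of `x` stays in the tuple.
    have e : ∀ (C : Struc) (f : Fin m → C.dom) (c : C.dom), Function.update (f ∘ ρ) x c =
        (Fin.cons c f : Fin (m + 1) → C.dom) ∘ Function.update (Fin.succ ∘ ρ) x 0 := by
      intro C f c
      funext j
      by_cases hj : j = x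
      · subst hj; simp
      · simp [hj]
    obtain ⟨h1, h2⟩ := tp_succ_iff.1 h
    constructor
    · rintro ⟨a, ha⟩
      obtain ⟨b, hb⟩ := h1 a
      refine ⟨b, ?_⟩
      erw [e A u a] at ha
      erw [e B w b]
      exact (ih hb hd _).1 ha
    · rintro ⟨b, hb'⟩
      obtain ⟨a, hb⟩ := h2 b
      refine ⟨a, ?_⟩
      erw [e B w b] at hb'
      erw [e A u a]
      exact (ih hb hd _).2 hb'

/-! ## Adding a root to a family of pointed structures -/

/-- The structure with a given accessibility relation and valuation, all of whose other relations
are empty. -/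
def Struc.ofKripke (W : Type) (hW : Nonempty W) (R : W → W → Prop) (V : ℕ → W → Prop) : Struc where
  dom := W
  nonempty := hW
  rel i n := match i, n with
    | 0, 2 => fun a => R (a 0) (a 1)
    | i, 1 => fun a => V i (a 0)
    | _, _ => fun _ => False

/-- The accessibility relation of `Struc.root`. -/
def rootAcc {I : Type} (X : I → Struc) (a : ∀ i, (X i).dom) :
    Option (Σ i, (X i).dom) → Option (Σ i, (X i).dom) → Prop
  | none, some p => p.2 = a p.1
  | some p, some p' => ∃ h : p.1 = p'.1, (X p'.1).acc (h ▸ p.2) p'.2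
  | _, none => False

/-- The valuation of `Struc.root`. -/
def rootVal {I : Type} (l : ℕ → Prop) (X : I → Struc) (i : ℕ) : Option (Σ i, (X i).dom) → Prop
  | none => l i
  | some p => (X p.1).val i p.2

/-- The disjoint union of the pointed structures `(X i, a i)` together with a new root, which
satisfies the propositional variables in `l` and whose successors are the points `a i`. -/
def Struc.root {I : Type} (l : ℕ → Prop) (X : I → Struc) (a : ∀ i, (X i).dom) : Struc :=
  Struc.ofKripke (Option (Σ i, (X i).dom)) ⟨none⟩ (rootAcc X a) (rootVal l X)

section Root

variable {I : Type} {l : ℕ → Prop} {X Y : I → Struc} {a : ∀ i, (X i).dom} {b : ∀ i, (Y i).dom}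

/-- The root of `Struc.root`. -/
def Struc.rootPt (l : ℕ → Prop) (X : I → Struc) (a : ∀ i, (X i).dom) : (Struc.root l X a).dom :=
  (none : Option (Σ i, (X i).dom))

/-- The inclusion of a component in `Struc.root`. -/
def Struc.rootIn (l : ℕ → Prop) (X : I → Struc) (a : ∀ i, (X i).dom) (i : I) (z : (X i).dom) :
    (Struc.root l X a).dom :=
  (some ⟨i, z⟩ : Option (Σ i, (X i).dom))

theorem root_cases (e : (Struc.root l X a).dom) :
    e = Struc.rootPt l X a ∨ ∃ i z, e = Struc.rootIn l X a i z := by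
  match e with
  | none => exact Or.inl rfl
  | some ⟨i, z⟩ => exact Or.inr ⟨i, z, rfl⟩

theorem root_val (i : ℕ) (e : (Struc.root l X a).dom) :
    (Struc.root l X a).val i e ↔ rootVal l X i e := by
  cases i <;> exact Iff.rfl

theorem root_val_pt (i : ℕ) : (Struc.root l X a).val i (Struc.rootPt l X a) ↔ l i := root_val i _

theorem root_val_in (p : ℕ) {i : I} {z : (X i).dom} :
    (Struc.root l X a).val p (Struc.rootIn l X a i z) ↔ (X i).val p z := root_val p _

theorem root_acc_pt_in {i : I} {z : (X i).dom} :
    (Struc.root l X a).acc (Struc.rootPt l X a) (Struc.rootIn l X a i z) ↔ z = a i := Iff.rfl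

theorem root_acc_pt {e : (Struc.root l X a).dom} :
    ¬ (Struc.root l X a).acc e (Struc.rootPt l X a) := by
  rcases root_cases e with rfl | ⟨i, z, rfl⟩ <;> exact fun h => h

theorem root_acc_in_in {i : I} {z z' : (X i).dom} :
    (Struc.root l X a).acc (Struc.rootIn l X a i z) (Struc.rootIn l X a i z') ↔
      (X i).acc z z' :=
  ⟨fun ⟨_, h⟩ => h, fun h => ⟨rfl, h⟩⟩

theorem root_acc_in_ne {i j : I} {z : (X i).dom} {z' : (X j).dom} (hij : i ≠ j) :
    ¬ (Struc.root l X a).acc (Struc.rootIn l X a i z) (Struc.rootIn l X a j z') :=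
  fun ⟨h, _⟩ => hij h

theorem rootIn_inj {i : I} {z z' : (X i).dom} :
    Struc.rootIn l X a i z = Struc.rootIn l X a i z' ↔ z = z' := by
  refine ⟨fun h => ?_, fun h => by rw [h]⟩
  have := Option.some.inj h
  simpa using this

theorem rootIn_ne {i j : I} {z : (X i).dom} {z' : (X j).dom} (hij : i ≠ j) :
    Struc.rootIn l X a i z ≠ Struc.rootIn l X a j z' := fun h =>
  hij (congrArg Sigma.fst (Option.some.inj h))

theorem rootIn_ne_pt {i : I} {z : (X i).dom} :
    Struc.rootIn l X a i z ≠ Struc.rootPt l X a := fun h => Option.some_ne_none _ h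

/-! ### Bisimilarity of rooted sums -/

/-- No edge leaves a component. -/
theorem nBisim_rootIn (k n : ℕ) (i : I) (z : (X i).dom) :
    NBisim k n (X i) z (Struc.root l X a) (Struc.rootIn l X a i z) := by
  induction n generalizing z with
  | zero => exact fun p _ => (root_val_in p).symm
  | succ n ih =>
    refine ⟨fun p _ => (root_val_in p).symm, fun z' h => ⟨_, root_acc_in_in.2 h, ih z'⟩,
      fun e h => ?_⟩
    rcases root_cases e with rfl | ⟨j, z', rfl⟩
    · exact (root_acc_pt h).elim
    · by_cases hij : i = j
      · subst hij
        exact ⟨z', root_acc_in_in.1 h, ih z'⟩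
      · exact (root_acc_in_ne hij h).elim

theorem nBisim_root {k n : ℕ} (h : ∀ i, NBisim k n (X i) (a i) (Y i) (b i)) :
    NBisim k (n + 1) (Struc.root l X a) (Struc.rootPt l X a)
      (Struc.root l Y b) (Struc.rootPt l Y b) := by
  refine ⟨fun p _ => (root_val_pt p).trans (root_val_pt p).symm, fun e he => ?_, fun e he => ?_⟩
  · rcases root_cases e with rfl | ⟨i, z, rfl⟩
    · exact (root_acc_pt he).elim
    · rw [root_acc_pt_in] at he
      subst he
      exact ⟨_, root_acc_pt_in.2 rfl,
        ((nBisim_rootIn k n i _).symm.trans (h i)).trans (nBisim_rootIn k n i _)⟩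
  · rcases root_cases e with rfl | ⟨i, z, rfl⟩
    · exact (root_acc_pt he).elim
    · rw [root_acc_pt_in] at he
      subst he
      exact ⟨_, root_acc_pt_in.2 rfl,
        ((nBisim_rootIn k n i _).symm.trans (h i)).trans (nBisim_rootIn k n i _)⟩

/-- If the family `X` runs through the successors of `c`, up to bisimilarity, then adding a root to
`X` yields a structure bisimilar to `(C, c)`. -/
theorem nBisim_unravel {k : ℕ} {C : Struc} {c : C.dom} (s : I → C.dom)
    (hs : ∀ d, C.acc c d ↔ ∃ i, s i = d) (hl : ∀ p < k, C.val p c ↔ l p)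
    (h : ∀ i n, NBisim k n C (s i) (X i) (a i)) (n : ℕ) :
    NBisim k n C c (Struc.root l X a) (Struc.rootPt l X a) := by
  have h0 : ∀ p < k, C.val p c ↔ (Struc.root l X a).val p (Struc.rootPt l X a) :=
    fun p hp => (hl p hp).trans (root_val_pt p).symm
  cases n with
  | zero => exact h0
  | succ n =>
    refine ⟨h0, fun d hd => ?_, fun e he => ?_⟩
    · obtain ⟨i, rfl⟩ := (hs d).1 hd
      exact ⟨_, root_acc_pt_in.2 rfl, (h i n).trans (nBisim_rootIn k n i _)⟩
    · rcases root_cases e with rfl | ⟨i, z, rfl⟩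
      · exact (root_acc_pt he).elim
      · rw [root_acc_pt_in] at he
        subst he
        exact ⟨_, (hs _).2 ⟨i, rfl⟩, (h i n).trans (nBisim_rootIn k n i _)⟩

/-! ### Composition of types in rooted sums -/

open Classical in
/-- The projection to the component `i`, which maps everything outside of it to `a i`. -/
noncomputable def rootProj (l : ℕ → Prop) (X : I → Struc) (a : ∀ i, (X i).dom) (i : I)
    (e : (Struc.root l X a).dom) : (X i).dom :=
  match (e : Option (Σ i, (X i).dom)) with
  | none => a i
  | some p => if h : p.1 = i then h ▸ p.2 else a i

theorem rootProj_pt (i : I) : rootProj l X a i (Struc.rootPt l X a) = a i := rfl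

theorem rootProj_in (i : I) (z : (X i).dom) : rootProj l X a i (Struc.rootIn l X a i z) = z := by
  simp [rootProj, Struc.rootIn]

theorem rootProj_in_ne {i j : I} (hij : i ≠ j) (z : (X i).dom) :
    rootProj l X a j (Struc.rootIn l X a i z) = a j := by
  simp [rootProj, Struc.rootIn, hij]

/-- The component of an element. -/
def rootIdx (l : ℕ → Prop) (X : I → Struc) (a : ∀ i, (X i).dom)
    (e : (Struc.root l X a).dom) : Option I :=
  Option.map Sigma.fst (e : Option (Σ i, (X i).dom))

theorem eq_pt_of_rootIdx {e : (Struc.root l X a).dom} (h : rootIdx l X a e = none) :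
    e = Struc.rootPt l X a := by
  rcases root_cases e with rfl | ⟨i, z, rfl⟩
  · rfl
  · cases h

theorem eq_in_of_rootIdx {e : (Struc.root l X a).dom} {i : I} (h : rootIdx l X a e = some i) :
    e = Struc.rootIn l X a i (rootProj l X a i e) := by
  rcases root_cases e with rfl | ⟨j, z, rfl⟩
  · cases h
  · obtain rfl := Option.some.inj h
    rw [rootProj_in]

theorem proj_cons {m : ℕ} (i : I) (e : (Struc.root l X a).dom)
    (u : Fin m → (Struc.root l X a).dom) :
    (rootProj l X a i ∘ (Fin.cons e u : Fin (m + 1) → _)) =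
      (Fin.cons (rootProj l X a i e) (rootProj l X a i ∘ u) : Fin (m + 1) → (X i).dom) := by
  funext j
  refine Fin.cases ?_ (fun j => ?_) j <;> simp

/-- The answer to the choice of `e` in one round of the Ehrenfeucht-Fraïssé game. -/
theorem root_answer {k q m : ℕ} {u : Fin m → (Struc.root l X a).dom}
    {w : Fin m → (Struc.root l Y b).dom} (j₀ : Fin m) (hu : u j₀ = Struc.rootPt l X a)
    (hw : w j₀ = Struc.rootPt l Y b)
    (h : ∀ i, tp k (q + 1) (X i) (rootProj l X a i ∘ u) = tp k (q + 1) (Y i) (rootProj l Y b i ∘ w))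
    (e : (Struc.root l X a).dom) :
    ∃ e' : (Struc.root l Y b).dom, rootIdx l X a e = rootIdx l Y b e' ∧
      ∀ i, tp k q (X i) (rootProj l X a i ∘ (Fin.cons e u : Fin (m + 1) → _)) =
        tp k q (Y i) (rootProj l Y b i ∘ (Fin.cons e' w : Fin (m + 1) → _)) := by
  -- A move outside component `i` projects to `a i`, which is already the coordinate `j₀`; in game
  -- `i` it is a harmless repetition.
  have hpt : ∀ i, tp k q (X i) (Fin.cons (a i) (rootProj l X a i ∘ u) : Fin (m + 1) → (X i).dom) =
      tp k q (Y i) (Fin.cons (b i) (rootProj l Y b i ∘ w) : Fin (m + 1) → (Y i).dom) := by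
    intro i
    have := tp_cons_coord (h i) j₀
    simpa only [Function.comp_apply, hu, hw, rootProj_pt] using this
  rcases root_cases e with rfl | ⟨j, z, rfl⟩
  · refine ⟨Struc.rootPt l Y b, rfl, fun i => ?_⟩
    rw [proj_cons, proj_cons]
    exact hpt i
  · obtain ⟨z', hz'⟩ := (tp_succ_iff.1 (h j)).1 z
    refine ⟨Struc.rootIn l Y b j z', rfl, fun i => ?_⟩
    rw [proj_cons, proj_cons]
    by_cases hij : j = i
    · subst hij
      rw [rootProj_in, rootProj_in]
      exact hz'
    · rw [rootProj_in_ne hij, rootProj_in_ne hij]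
      exact hpt i

/-- The games on all components are played at once. Keeping the root among the chosen elements makes
every `a i` a coordinate of game `i`. -/
theorem tp_root_aux {k q m : ℕ} {u : Fin m → (Struc.root l X a).dom}
    {w : Fin m → (Struc.root l Y b).dom} (j₀ : Fin m) (hu : u j₀ = Struc.rootPt l X a)
    (hw : w j₀ = Struc.rootPt l Y b) (hidx : ∀ j, rootIdx l X a (u j) = rootIdx l Y b (w j))
    (h : ∀ i, tp k q (X i) (rootProj l X a i ∘ u) = tp k q (Y i) (rootProj l Y b i ∘ w)) :
    tp k q (Struc.root l X a) u = tp k q (Struc.root l Y b) w := by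
  induction q generalizing m with
  | zero =>
    have h' := fun i => tp_zero_iff.1 (h i)
    refine tp_zero_iff.2 ⟨fun j j' => ?_, fun j j' => ?_, fun p hp j => ?_⟩
    · rcases hj : rootIdx l X a (u j) with _ | i <;> rcases hj' : rootIdx l X a (u j') with _ | i'
      · rw [eq_pt_of_rootIdx hj, eq_pt_of_rootIdx hj', eq_pt_of_rootIdx ((hidx j).symm.trans hj),
          eq_pt_of_rootIdx ((hidx j').symm.trans hj')]
        simp
      · rw [eq_pt_of_rootIdx hj, eq_in_of_rootIdx hj', eq_pt_of_rootIdx ((hidx j).symm.trans hj),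
          eq_in_of_rootIdx ((hidx j').symm.trans hj')]
        exact iff_of_false rootIn_ne_pt.symm rootIn_ne_pt.symm
      · rw [eq_in_of_rootIdx hj, eq_pt_of_rootIdx hj', eq_in_of_rootIdx ((hidx j).symm.trans hj),
          eq_pt_of_rootIdx ((hidx j').symm.trans hj')]
        exact iff_of_false rootIn_ne_pt rootIn_ne_pt
      · rw [eq_in_of_rootIdx hj, eq_in_of_rootIdx hj', eq_in_of_rootIdx ((hidx j).symm.trans hj),
          eq_in_of_rootIdx ((hidx j').symm.trans hj')]
        by_cases hi : i = i'
        · subst hi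
          rw [rootIn_inj, rootIn_inj]
          exact (h' i).1 j j'
        · exact iff_of_false (rootIn_ne hi) (rootIn_ne hi)
    · rcases hj' : rootIdx l X a (u j') with _ | i'
      · rw [eq_pt_of_rootIdx hj', eq_pt_of_rootIdx ((hidx j').symm.trans hj')]
        exact iff_of_false root_acc_pt root_acc_pt
      rcases hj : rootIdx l X a (u j) with _ | i
      · rw [eq_pt_of_rootIdx hj, eq_in_of_rootIdx hj', eq_pt_of_rootIdx ((hidx j).symm.trans hj),
          eq_in_of_rootIdx ((hidx j').symm.trans hj'), root_acc_pt_in, root_acc_pt_in]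
        -- An edge from the root is an equality with `a i'`, the coordinate `j₀`.
        have := (h' i').1 j' j₀
        simpa only [Function.comp_apply, hu, hw, rootProj_pt] using this
      · rw [eq_in_of_rootIdx hj, eq_in_of_rootIdx hj', eq_in_of_rootIdx ((hidx j).symm.trans hj),
          eq_in_of_rootIdx ((hidx j').symm.trans hj')]
        by_cases hi : i = i'
        · subst hi
          rw [root_acc_in_in, root_acc_in_in]
          exact (h' i).2.1 j j'
        · exact iff_of_false (root_acc_in_ne hi) (root_acc_in_ne hi)
    · rw [root_val, root_val]
      rcases hj : rootIdx l X a (u j) with _ | i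
      · rw [eq_pt_of_rootIdx hj, eq_pt_of_rootIdx ((hidx j).symm.trans hj)]
        exact Iff.rfl
      · rw [eq_in_of_rootIdx hj, eq_in_of_rootIdx ((hidx j).symm.trans hj)]
        exact (h' i).2.2 p hp j
  | succ q ih =>
    refine tp_succ_iff.2 ⟨fun e => ?_, fun e' => ?_⟩
    · obtain ⟨e', h1, h2⟩ := root_answer j₀ hu hw h e
      exact ⟨e', ih j₀.succ (by simpa using hu) (by simpa using hw)
        (fun j => Fin.cases (by simpa using h1) (fun j => by simpa using hidx j) j) h2⟩
    · obtain ⟨e, h1, h2⟩ := root_answer j₀ hw hu (fun i => (h i).symm) e'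
      exact ⟨e, ih j₀.succ (by simpa using hu) (by simpa using hw)
        (fun j => Fin.cases (by simpa using h1.symm) (fun j => by simpa using hidx j) j)
        fun i => (h2 i).symm⟩

/-- The type of a pointed structure. -/
abbrev ptp (k q : ℕ) (A : Struc) (a : A.dom) : Ty k q 1 := tp k q A fun _ => a

/-- The type of `Struc.root` is determined by the types of the components. -/
theorem ptp_root {k q : ℕ} (h : ∀ i, ptp k q (X i) (a i) = ptp k q (Y i) (b i)) :
    ptp k q (Struc.root l X a) (Struc.rootPt l X a) =
      ptp k q (Struc.root l Y b) (Struc.rootPt l Y b) :=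
  tp_root_aux 0 rfl rfl (fun _ => rfl) h

end Root

/-! ## Pairs of types realized by boundedly bisimilar structures -/

/-- The pairs of types of `Struc.root l X a` and `Struc.root l Y b`, where the types of the
components are in `D`. -/
def stepPairs (k q : ℕ) (D : Set (Ty k q 1 × Ty k q 1)) : Set (Ty k q 1 × Ty k q 1) :=
  {t | ∃ (I : Type) (l : ℕ → Prop) (X Y : I → Struc) (a : ∀ i, (X i).dom) (b : ∀ i, (Y i).dom),
    (∀ i, (ptp k q (X i) (a i), ptp k q (Y i) (b i)) ∈ D) ∧
    t = (ptp k q (Struc.root l X a) (Struc.rootPt l X a),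
      ptp k q (Struc.root l Y b) (Struc.rootPt l Y b))}

/-- The `n`-fold iteration of `stepPairs`, starting from the types of `0`-bisimilar structures. -/
def pairs (k q : ℕ) : ℕ → Set (Ty k q 1 × Ty k q 1)
  | 0 => {t | ∃ (A B : Struc) (a : A.dom) (b : B.dom),
      NBisim k 0 A a B b ∧ t = (ptp k q A a, ptp k q B b)}
  | n + 1 => stepPairs k q (pairs k q n)

theorem stepPairs_mono (k q : ℕ) : Monotone (stepPairs k q) := by
  rintro D D' h _ ⟨I, l, X, Y, a, b, h1, rfl⟩
  exact ⟨I, l, X, Y, a, b, fun i => h (h1 i), rfl⟩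

/-- With monotonicity of the operator, this first inclusion makes the whole sequence decreasing. It
holds because both roots carry the same label. -/
theorem pairs_one_subset (k q : ℕ) : pairs k q 1 ⊆ pairs k q 0 := by
  rintro _ ⟨I, l, X, Y, a, b, -, rfl⟩
  exact ⟨_, _, Struc.rootPt l X a, Struc.rootPt l Y b,
    fun p _ => (root_val_pt p).trans (root_val_pt p).symm, rfl⟩

/-- The components witnessing membership need not be bisimilar; only their types are constrained.
They are replaced by bisimilar ones of the same types, which leaves the types of the rooted sums
unchanged. -/
theorem exists_nBisim_of_mem_pairs {k q n : ℕ} {t : Ty k q 1 × Ty k q 1} (ht : t ∈ pairs k q n) :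
    ∃ (A B : Struc) (a : A.dom) (b : B.dom),
      NBisim k n A a B b ∧ t = (ptp k q A a, ptp k q B b) := by
  induction n generalizing t with
  | zero => exact ht
  | succ n ih =>
    obtain ⟨I, l, X, Y, a, b, h, rfl⟩ := ht
    choose X' Y' a' b' h1 h2 using fun i => ih (h i)
    exact ⟨Struc.root l X' a', Struc.root l Y' b', _, _, nBisim_root h1,
      Prod.ext (ptp_root fun i => congrArg Prod.fst (h2 i))
        (ptp_root fun i => congrArg Prod.snd (h2 i))⟩

theorem exists_mem_pairs_of_nBisim {k n : ℕ} (q : ℕ) {A B : Struc} {a : A.dom} {b : B.dom}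
    (h : NBisim k n A a B b) : ∃ (A' B' : Struc) (a' : A'.dom) (b' : B'.dom),
      (∀ m, NBisim k m A a A' a') ∧ (∀ m, NBisim k m B b B' b') ∧
      (ptp k q A' a', ptp k q B' b') ∈ pairs k q n := by
  induction n generalizing a b with
  | zero => exact ⟨A, B, a, b, fun m => .refl k m A a, fun m => .refl k m B b, A, B, a, b, h, rfl⟩
  | succ n ih =>
    -- Indexing by matched pairs of successors gives both sums the same index set. A successor may
    -- be copied many times, which bisimilarity does not notice.
    let I := {p : A.dom × B.dom // A.acc a p.1 ∧ B.acc b p.2 ∧ NBisim k n A p.1 B p.2}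
    choose X Y s t h1 h2 h3 using fun p : I => ih p.2.2.2
    refine ⟨Struc.root (fun i => A.val i a) X s, Struc.root (fun i => A.val i a) Y t, _, _,
      nBisim_unravel (fun p : I => p.1.1) (fun d => ?_) (fun _ _ => Iff.rfl) h1,
      nBisim_unravel (fun p : I => p.1.2) (fun d => ?_) (fun p hp => (h.1 p hp).symm) h2,
      I, _, X, Y, s, t, h3, rfl⟩
    · constructor
      · intro hd
        obtain ⟨d', h4, h5⟩ := h.2.1 d hd
        exact ⟨⟨(d, d'), hd, h4, h5⟩, rfl⟩
      · rintro ⟨p, rfl⟩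
        exact p.2.1
    · constructor
      · intro hd
        obtain ⟨d', h4, h5⟩ := h.2.2 d hd
        exact ⟨⟨(d', d), h4, hd, h5⟩, rfl⟩
      · rintro ⟨p, rfl⟩
        exact p.2.2.1

/-- A decreasing sequence obtained by iterating a monotone operator on the subsets of a finite type
is constant from the cardinality of the type on. -/
theorem subset_of_iterate {α : Type} [Finite α] {Φ : Set α → Set α} (hΦ : Monotone Φ)
    {D : ℕ → Set α} (hD : ∀ n, D (n + 1) = Φ (D n)) (h0 : D 1 ⊆ D 0) (n : ℕ) :
    D (Nat.card α) ⊆ D n := by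
  have hstep : ∀ m, D (m + 1) ⊆ D m := by
    intro m
    induction m with
    | zero => exact h0
    | succ m ih => exact (hD (m + 1)).trans_subset ((hΦ ih).trans (hD m).symm.subset)
  have hanti : Antitone D := antitone_nat_of_succ_le hstep
  obtain ⟨m, hm, hm'⟩ : ∃ m ≤ Nat.card α, D (m + 1) = D m := by
    by_contra! hne
    -- While the inclusions are strict, each step loses an element; `Nat.card α + 1` steps are too
    -- many.
    have : ∀ m ≤ Nat.card α + 1, (D m).ncard + m ≤ Nat.card α := by
      intro m hm
      induction m with
      | zero => simpa using Set.ncard_le_card (D 0)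
      | succ m ih =>
        have h1 := ih (by omega)
        have h2 := Set.ncard_lt_ncard ((hstep m).ssubset_of_ne (hne m (by omega))) (Set.toFinite _)
        omega
    have := this _ le_rfl
    omega
  have hconst : ∀ j, D (m + j) = D m := by
    intro j
    induction j with
    | zero => rfl
    | succ j ih => rw [← add_assoc, hD, ih, ← hD, hm']
  refine (hanti hm).trans ?_
  rcases le_total n m with h | h
  · exact hanti h
  · obtain ⟨j, rfl⟩ := Nat.exists_eq_add_of_le h
    exact (hconst j).ge

/-- The modal depth that suffices for formulas of quantifier rank `q`. -/
def depthBound (k q : ℕ) : ℕ := tyCard k q 1 * tyCard k q 1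

/-- A modal formula that is equivalent to a first-order formula of quantifier rank `q` is invariant
under `depthBound k q`-bisimilarity, whatever its modal depth. -/
theorem ML.sat_iff_of_nBisim {k q : ℕ} {φ : FO} {χ : ML} {x y : ℕ} (hxy : x ≠ y) (hq : φ.qr ≤ q)
    (h : ∀ (A : Struc) (v : ℕ → A.dom), φ.Sat A v ↔ (χ.st x y).Sat A v)
    {A B : Struc} {a : A.dom} {b : B.dom} (hab : NBisim k (depthBound k q) A a B b) :
    χ.Sat (A.red (· < k)) a ↔ χ.Sat (B.red (· < k)) b := by
  obtain ⟨A₁, B₁, a₁, b₁, hA, hB, hmem⟩ := exists_mem_pairs_of_nBisim q hab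
  have hle : pairs k q (depthBound k q) ⊆ pairs k q χ.depth := by
    have := subset_of_iterate (stepPairs_mono k q) (D := pairs k q) (fun _ => rfl)
      (pairs_one_subset k q) χ.depth
    rwa [Nat.card_prod, card_ty] at this
  obtain ⟨A₂, B₂, a₂, b₂, h₂, ht⟩ := exists_nBisim_of_mem_pairs (hle hmem)
  have key : ∀ {C C' : Struc} {c : C.dom} {c' : C'.dom}, ptp k q C c = ptp k q C' c' →
      (χ.Sat (C.red (· < k)) c ↔ χ.Sat (C'.red (· < k)) c') := by
    intro C C' c c' hc
    have h1 := h (C.red (· < k)) ((fun _ => c) ∘ fun _ => (0 : Fin 1))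
    have h2 := h (C'.red (· < k)) ((fun _ => c') ∘ fun _ => (0 : Fin 1))
    rw [ML.sat_st _ _ hxy] at h1 h2
    exact h1.symm.trans ((FO.sat_iff_of_tp hc φ hq fun _ => 0).trans h2)
  -- The outer steps use bisimilarity at every depth, the next ones equality of types and `φ`, the
  -- middle one bisimilarity to the depth of `χ`.
  calc χ.Sat (A.red (· < k)) a
      ↔ χ.Sat (A₁.red (· < k)) a₁ := (hA _).sat_iff χ le_rfl
    _ ↔ χ.Sat (A₂.red (· < k)) a₂ := key (congrArg Prod.fst ht)
    _ ↔ χ.Sat (B₂.red (· < k)) b₂ := h₂.sat_iff χ le_rfl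
    _ ↔ χ.Sat (B₁.red (· < k)) b₁ := (key (congrArg Prod.snd ht)).symm
    _ ↔ χ.Sat (B.red (· < k)) b := ((hB _).sat_iff χ le_rfl).symm

/-! ## Representatives of the modal formulas of bounded depth -/

/-- The modal formula `(α ∧ β) ∨ (¬ α ∧ γ)`. -/
def ML.cond (α β γ : ML) : ML := .not (.and (.not (.and α β)) (.not (.and (.not α) γ)))

theorem ML.sat_cond {A : Struc} {α β γ : ML} {a : A.dom} :
    (ML.cond α β γ).Sat A a ↔ (α.Sat A a ∧ β.Sat A a) ∨ (¬ α.Sat A a ∧ γ.Sat A a) := by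
  simp only [ML.cond, ML.Sat]
  tauto

/-- Up to equivalence, the Boolean combinations of the formulas in a list. -/
def ML.boolComb (l : List ML) : List ML :=
  l.foldr (fun α r => r.flatMap fun β => r.map fun γ => ML.cond α β γ) [.top, .not .top]

/-- The propositional variables with index below `k`. -/
def ML.props (k : ℕ) : List ML := (List.range k).map .var

/-- Up to equivalence, the modal formulas of depth at most `n` over the propositional variables
with index below `k`. -/
def ML.level (k : ℕ) : ℕ → List ML
  | 0 => ML.boolComb (ML.props k)
  | n + 1 => ML.boolComb (ML.props k ++ (ML.level k n).map .dia)

/-- Shannon expansion along the head `α`. With an empty list, `P` is constant. -/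
theorem ML.exists_mem_boolComb (l : List ML) (P : (A : Struc) → A.dom → Prop)
    (hP : ∀ (A B : Struc) (a : A.dom) (b : B.dom), (∀ χ ∈ l, χ.Sat A a ↔ χ.Sat B b) →
      (P A a ↔ P B b)) :
    ∃ χ ∈ ML.boolComb l, ∀ (A : Struc) (a : A.dom), χ.Sat A a ↔ P A a := by
  induction l generalizing P with
  | nil =>
    by_cases h : ∃ (A : Struc) (a : A.dom), P A a
    · obtain ⟨A, a, h⟩ := h
      exact ⟨.top, by simp [boolComb], fun B b =>
        iff_of_true trivial ((hP A B a b (by simp)).1 h)⟩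
    · push Not at h
      exact ⟨.not .top, by simp [boolComb], fun B b => iff_of_false (fun h => h trivial) (h B b)⟩
  | cons α l ih =>
    -- The cofactor of `P` at a truth value of `α` is made invariant for the tail by closing it
    -- under agreement on `l`; `Q` selects the truth value.
    have aux : ∀ Q : Prop → Prop, ∃ χ ∈ ML.boolComb l, ∀ (A : Struc) (a : A.dom), χ.Sat A a ↔
        ∃ (B : Struc) (b : B.dom), (∀ χ ∈ l, χ.Sat A a ↔ χ.Sat B b) ∧ Q (α.Sat B b) ∧ P B b := by
      intro Q
      refine ih _ fun A A' a a' h => ?_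
      refine exists_congr fun B => exists_congr fun b => and_congr_left fun _ => ?_
      exact forall₂_congr fun χ hχ => by rw [h χ hχ]
    obtain ⟨β, hβ, hβ'⟩ := aux fun p => p
    obtain ⟨γ, hγ, hγ'⟩ := aux fun p => ¬ p
    refine ⟨ML.cond α β γ, List.mem_flatMap.2 ⟨β, hβ, List.mem_map.2 ⟨γ, hγ, rfl⟩⟩, fun A a => ?_⟩
    rw [ML.sat_cond, hβ', hγ']
    constructor
    · rintro (⟨h1, B, b, h2, h3, h4⟩ | ⟨h1, B, b, h2, h3, h4⟩)
      · exact (hP A B a b (List.forall_mem_cons.2 ⟨iff_of_true h1 h3, h2⟩)).2 h4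
      · exact (hP A B a b (List.forall_mem_cons.2 ⟨iff_of_false h1 h3, h2⟩)).2 h4
    · intro h
      by_cases h1 : α.Sat A a
      · exact Or.inl ⟨h1, A, a, fun _ _ => Iff.rfl, h1, h⟩
      · exact Or.inr ⟨h1, A, a, fun _ _ => Iff.rfl, h1, h⟩

theorem ML.val_iff_of_props {k : ℕ} {A B : Struc} {a : A.dom} {b : B.dom}
    (h : ∀ χ ∈ ML.props k, χ.Sat A a ↔ χ.Sat B b) : ∀ i < k, A.val i a ↔ B.val i b :=
  fun i hi => h (.var i) (List.mem_map.2 ⟨i, List.mem_range.2 hi, rfl⟩)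

/-- Every property that is invariant under `n`-bisimilarity is defined by a member of
`ML.level k n`. -/
theorem ML.exists_mem_level (k n : ℕ) (P : (A : Struc) → A.dom → Prop)
    (hP : ∀ (A B : Struc) (a : A.dom) (b : B.dom), NBisim k n A a B b → (P A a ↔ P B b)) :
    ∃ χ ∈ ML.level k n, ∀ (A : Struc) (a : A.dom), χ.Sat A a ↔ P A a := by
  induction n generalizing P with
  | zero =>
    exact ML.exists_mem_boolComb _ P fun A B a b h => hP A B a b (ML.val_iff_of_props h)
  | succ n ih =>
    have forth : ∀ (A B : Struc) (a : A.dom) (b : B.dom),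
        (∀ χ ∈ ML.level k n, (ML.dia χ).Sat A a → (ML.dia χ).Sat B b) →
        ∀ a', A.acc a a' → ∃ b', B.acc b b' ∧ NBisim k n A a' B b' := by
      intro A B a b h a' ha
      -- `χ` is the characteristic formula of `a'` for `n`-bisimilarity.
      obtain ⟨χ, hχ, hχ'⟩ := ih (fun C c => NBisim k n A a' C c) fun C C' c c' hc =>
        ⟨fun h => h.trans hc, fun h => h.trans hc.symm⟩
      obtain ⟨b', h1, h2⟩ := h χ hχ ⟨a', ha, (hχ' _ _).2 (.refl k n A a')⟩
      exact ⟨b', h1, (hχ' _ _).1 h2⟩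
    refine ML.exists_mem_boolComb _ P fun A B a b h => hP A B a b ?_
    rw [List.forall_mem_append] at h
    have hdia : ∀ χ ∈ ML.level k n, (ML.dia χ).Sat A a ↔ (ML.dia χ).Sat B b := fun χ hχ =>
      h.2 _ (List.mem_map.2 ⟨χ, hχ, rfl⟩)
    refine ⟨ML.val_iff_of_props h.1, forth A B a b fun χ hχ => (hdia χ hχ).1, fun b' hb => ?_⟩
    obtain ⟨a', h1, h2⟩ := forth B A b a (fun χ hχ => (hdia χ hχ).2) b' hb
    exact ⟨a', h1, h2.symm⟩

/-- A formula that is definable by a modal formula is definable by one from a finite list. -/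
theorem MLDefinable.exists_mem_level {k q x y : ℕ} (hxy : x ≠ y) {φ : FO} (hq : φ.qr ≤ q)
    (hk : φ.UnaryIn (· < k)) (h : MLDefinable x y φ) :
    ∃ χ ∈ ML.level k (depthBound k q),
      φ.Entails (χ.st x y) ∧ (χ.st x y).Entails φ := by
  obtain ⟨χ, h1, h2⟩ := h
  have hiff : ∀ (A : Struc) (v : ℕ → A.dom), φ.Sat A v ↔ (χ.st x y).Sat A v := fun A v =>
    ⟨h1 A v, h2 A v⟩
  obtain ⟨χ', hmem, hχ'⟩ := ML.exists_mem_level k (depthBound k q)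
    (fun A a => χ.Sat (A.red (· < k)) a) fun A B a b => ML.sat_iff_of_nBisim hxy hq hiff
  have key : ∀ (A : Struc) (v : ℕ → A.dom), φ.Sat A v ↔ (χ'.st x y).Sat A v := by
    intro A v
    have hmod : ∀ (B : Struc) (w : ℕ → B.dom), φ.Sat B w ↔ χ.Sat B (w x) := fun B w =>
      (hiff B w).trans (ML.sat_st B χ hxy w)
    have h3 := hmod A v
    have h4 := hmod (A.red fun _ => True) v
    have h5 := hmod (A.red (· < k)) v
    rw [ML.sat_st _ _ hxy, hχ']
    -- `χ` ignores all symbols but the accessibility relation and the unary ones, hence so does `φ`;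
    -- moreover, `φ` mentions no unary one of index `k` or more.
    calc φ.Sat A v ↔ χ.Sat A (v x) := h3
      _ ↔ χ.Sat (A.red fun _ => True) (v x) := (ML.sat_red_univ A χ (v x)).symm
      _ ↔ φ.Sat (A.red fun _ => True) v := h4.symm
      _ ↔ φ.Sat (A.red (· < k)) v := FO.sat_red_univ A φ hk v
      _ ↔ χ.Sat (A.red (· < k)) (v x) := h5
  exact ⟨χ', hmem, fun A v => (key A v).1, fun A v => (key A v).2⟩

/-! ### Bounds from the Gödel number -/

theorem FO.qr_le_encodeFO (φ : FO) : φ.qr ≤ φ.encodeFO := by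
  induction φ with
  | top => simp [FO.qr]
  | rel i args => simp [FO.qr]
  | eq x y => simp [FO.qr]
  | and φ ψ h1 h2 =>
    have := Nat.left_le_pair φ.encodeFO ψ.encodeFO
    have := Nat.right_le_pair φ.encodeFO ψ.encodeFO
    simp only [FO.qr, FO.encodeFO]; omega
  | not φ h => simp only [FO.qr, FO.encodeFO]; omega
  | ex x φ h =>
    have := Nat.right_le_pair x φ.encodeFO
    simp only [FO.qr, FO.encodeFO]; omega

/-- The code of `φ` bounds both parameters, so neither has to be computed from the syntax. -/
theorem FO.unaryIn_encodeFO (φ : FO) {k : ℕ} (hk : φ.encodeFO < k) : φ.UnaryIn (· < k) := by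
  induction φ with
  | top => trivial
  | rel i args =>
    have := Nat.left_le_pair i (Encodable.encode args)
    simp only [FO.encodeFO, FO.UnaryIn] at *
    omega
  | eq x y => trivial
  | and φ ψ h1 h2 =>
    have := Nat.left_le_pair φ.encodeFO ψ.encodeFO
    have := Nat.right_le_pair φ.encodeFO ψ.encodeFO
    simp only [FO.encodeFO] at hk
    exact ⟨h1 (by omega), h2 (by omega)⟩
  | not φ h => simp only [FO.encodeFO] at hk; exact h (by omega)
  | ex x φ h =>
    have := Nat.right_le_pair x φ.encodeFO
    simp only [FO.encodeFO] at hk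
    exact h (by omega)

/-! ## Computability -/

open Primrec in
theorem FO.primrec_and : Primrec₂ FO.and :=
  Primrec₂.encode_iff.1 <| (nat_add.comp (nat_mul.comp (const 5)
    (Primrec₂.natPair.comp (Primrec.encode.comp fst) (Primrec.encode.comp snd))) (const 3) :
    Primrec fun p : FO × FO => 5 * Nat.pair (Encodable.encode p.1) (Encodable.encode p.2) + 3)

open Primrec in
theorem FO.primrec_not : Primrec FO.not :=
  Primrec.encode_iff.1 <| (nat_add.comp (nat_mul.comp (const 5) Primrec.encode) (const 4) :
    Primrec fun φ : FO => 5 * Encodable.encode φ + 4)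

open Primrec in
theorem FO.primrec_ex (x : ℕ) : Primrec (FO.ex x) :=
  Primrec.encode_iff.1 <| (nat_add.comp (nat_mul.comp (const 5)
    (Primrec₂.natPair.comp (const x) Primrec.encode)) (const 5) :
    Primrec fun φ : FO => 5 * Nat.pair x (Encodable.encode φ) + 5)

open Primrec in
theorem FO.primrec_rel (args : List ℕ) : Primrec fun i => FO.rel i args :=
  Primrec.encode_iff.1 <| (nat_add.comp (nat_mul.comp (const 5)
    (Primrec₂.natPair.comp Primrec.id (const (Encodable.encode args)))) (const 1) :
    Primrec fun i : ℕ => 5 * Nat.pair i (Encodable.encode args) + 1)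

/-- Both standard translations of a modal formula. -/
def ML.stPair (x y : ℕ) (χ : ML) : FO × FO := (χ.st x y, χ.st y x)

/-- The counterpart of `ML.cond` for first-order formulas. -/
def FO.cond (α β γ : FO) : FO := .not (.and (.not (.and α β)) (.not (.and (.not α) γ)))

theorem FO.primrec_cond {α : Type} [Primcodable α] {f g h : α → FO} (hf : Primrec f)
    (hg : Primrec g) (hh : Primrec h) : Primrec fun a => FO.cond (f a) (g a) (h a) :=
  FO.primrec_not.comp <| FO.primrec_and.comp
    (FO.primrec_not.comp (FO.primrec_and.comp hf hg))
    (FO.primrec_not.comp (FO.primrec_and.comp (FO.primrec_not.comp hf) hh))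

/-- The counterpart of `ML.boolComb` for pairs of first-order formulas. -/
def FO.boolComb (x y : ℕ) (l : List (FO × FO)) : List (FO × FO) :=
  l.foldr (fun α r => r.flatMap fun β => r.map fun γ =>
    (FO.cond α.1 β.1 γ.1, FO.cond α.2 β.2 γ.2)) [ML.top.stPair x y, (ML.not .top).stPair x y]

/-- The counterpart of `ML.level` for pairs of first-order formulas. -/
def FO.level (x y k n : ℕ) : List (FO × FO) :=
  n.rec (FO.boolComb x y ((List.range k).map fun i => (.rel i [x], .rel i [y])))
    fun _ r => FO.boolComb x y ((List.range k).map (fun i => (.rel i [x], .rel i [y])) ++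
      r.map fun p => (.ex y (.and (.rel 0 [x, y]) p.2), .ex x (.and (.rel 0 [y, x]) p.1)))

theorem FO.boolComb_map (x y : ℕ) (l : List ML) :
    FO.boolComb x y (l.map (ML.stPair x y)) = (ML.boolComb l).map (ML.stPair x y) := by
  induction l with
  | nil => rfl
  | cons α l ih =>
    have h1 : FO.boolComb x y ((α :: l).map (ML.stPair x y)) =
      (FO.boolComb x y (l.map (ML.stPair x y))).flatMap fun β =>
        (FO.boolComb x y (l.map (ML.stPair x y))).map fun γ =>
          (FO.cond (α.stPair x y).1 β.1 γ.1, FO.cond (α.stPair x y).2 β.2 γ.2) := rfl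
    have h2 : ML.boolComb (α :: l) =
      (ML.boolComb l).flatMap fun β => (ML.boolComb l).map fun γ => ML.cond α β γ := rfl
    rw [h1, h2, ih]
    simp only [List.flatMap_map, List.map_flatMap, List.map_map]
    rfl

/-- A diamond swaps the two variables, so both translations are carried along; the recursion then
runs on codes of first-order formulas alone. -/
theorem FO.level_eq (x y k n : ℕ) :
    FO.level x y k n = (ML.level k n).map (ML.stPair x y) := by
  have h0 : ((List.range k).map fun i => (FO.rel i [x], FO.rel i [y])) =
      (ML.props k).map (ML.stPair x y) := by
    simp only [ML.props, List.map_map]; rfl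
  induction n with
  | zero =>
    have : FO.level x y k 0 =
      FO.boolComb x y ((List.range k).map fun i => (.rel i [x], .rel i [y])) := rfl
    rw [this, h0, FO.boolComb_map, ML.level]
  | succ n ih =>
    have : FO.level x y k (n + 1) =
      FO.boolComb x y ((List.range k).map (fun i => (.rel i [x], .rel i [y])) ++
        (FO.level x y k n).map fun p =>
          (.ex y (.and (.rel 0 [x, y]) p.2), .ex x (.and (.rel 0 [y, x]) p.1))) := rfl
    rw [this, h0, ih, ML.level, ← FO.boolComb_map, List.map_append, List.map_map, List.map_map]
    rfl

open Primrec in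
theorem FO.primrec_boolComb (x y : ℕ) : Primrec (FO.boolComb x y) := by
  have hc : Primrec fun t : (List (FO × FO) × ((FO × FO) × List (FO × FO))) × (FO × FO) × (FO × FO) =>
      (FO.cond t.1.2.1.1 t.2.1.1 t.2.2.1, FO.cond t.1.2.1.2 t.2.1.2 t.2.2.2) := by
    have hα := fst.comp (snd.comp (fst (α := List (FO × FO) × ((FO × FO) × List (FO × FO)))
      (β := (FO × FO) × (FO × FO))))
    have hβ := fst.comp (snd (α := List (FO × FO) × ((FO × FO) × List (FO × FO)))
      (β := (FO × FO) × (FO × FO)))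
    have hγ := snd.comp (snd (α := List (FO × FO) × ((FO × FO) × List (FO × FO)))
      (β := (FO × FO) × (FO × FO)))
    exact pair (FO.primrec_cond (fst.comp hα) (fst.comp hβ) (fst.comp hγ))
      (FO.primrec_cond (snd.comp hα) (snd.comp hβ) (snd.comp hγ))
  refine list_foldr (h := fun _ (p : (FO × FO) × List (FO × FO)) => p.2.flatMap fun β =>
    p.2.map fun γ => (FO.cond p.1.1 β.1 γ.1, FO.cond p.1.2 β.2 γ.2)) Primrec.id (const _) ?_
  refine list_flatMap (snd.comp snd) ?_
  refine list_map (snd.comp (snd.comp fst)) ?_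
  exact hc.comp (pair (fst.comp fst) (pair (snd.comp fst) snd))

open Primrec in
theorem FO.primrec_level (x y : ℕ) : Primrec₂ (FO.level x y) := by
  have hp : Primrec fun k : ℕ => (List.range k).map fun i => (FO.rel i [x], FO.rel i [y]) :=
    list_map list_range ((pair (FO.primrec_rel [x]) (FO.primrec_rel [y])).comp snd)
  refine Primrec.nat_rec
    (g := fun k (t : ℕ × List (FO × FO)) => FO.boolComb x y
      ((List.range k).map (fun i => (.rel i [x], .rel i [y])) ++ t.2.map fun p =>
        (.ex y (.and (.rel 0 [x, y]) p.2), .ex x (.and (.rel 0 [y, x]) p.1))))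
    ((FO.primrec_boolComb x y).comp hp) ?_
  refine (FO.primrec_boolComb x y).comp (list_append.comp (hp.comp fst) ?_)
  refine list_map (snd.comp snd) ?_
  exact pair ((FO.primrec_ex y).comp (FO.primrec_and.comp (const _) (snd.comp snd)))
    ((FO.primrec_ex x).comp (FO.primrec_and.comp (const _) (fst.comp snd)))

open Primrec in
theorem primrec_two_pow : Primrec fun n : ℕ => 2 ^ n :=
  (nat_rec₁ (f := fun _ m => m * 2) 1 (nat_mul.comp₂ Primrec₂.right (Primrec₂.const 2))).of_eq fun n => by
    induction n with
    | zero => rfl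
    | succ n ih => simp [ih, pow_succ]

open Primrec in
theorem primrec_depthBound : Primrec fun n : ℕ => depthBound (n + 1) n := by
  have h1 : Primrec fun n : ℕ => 1 + n := nat_add.comp (const 1) Primrec.id
  have h2 : Primrec fun n : ℕ => (1 + n) * (1 + n) := nat_mul.comp h1 h1
  have h3 : Primrec fun n : ℕ => (n + 1) * (1 + n) := nat_mul.comp Primrec.succ h1
  have h4 : Primrec fun n : ℕ => tyCard (n + 1) n 1 :=
    nat_iterate Primrec.id (primrec_two_pow.comp (nat_add.comp (nat_add.comp h2 h2) h3))
      (primrec_two_pow.comp snd)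
  exact nat_mul.comp h4 h4

/-! ### Assembling the decision procedure -/

/-- Whether a decidable property holds for some member of a computable list is decidable. -/
theorem DecidableOn.exists_mem {α β : Type} [Primcodable α] [Primcodable β] [Inhabited β]
    {S : Set α} {T : Set (α × β)} {P : α × β → Prop} (hP : DecidableOn T P) {L : α → List β}
    (hL : Computable L) (hLT : ∀ a ∈ S, ∀ b ∈ L a, (a, b) ∈ T) :
    DecidableOn S fun a => ∃ b ∈ L a, P (a, b) := by
  obtain ⟨f, hf, hfT⟩ := hP
  let h : α → ℕ × Bool →. Bool := fun a t =>
    -- Every member is tested, even after a success; all tests halt because the pairs lie in `T`.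
    -- The default is never reached below the length.
    (f (a, (L a).getD t.1 default)).map fun c => t.2 || c
  have hh : Partrec₂ h := by
    refine Partrec.map (f := fun p : α × (ℕ × Bool) => f (p.1, (L p.1).getD p.2.1 default))
      (g := fun p c => p.2.2 || c) ?_ ?_
    · exact hf.comp (Computable.fst.pair ((Primrec.list_getD default).to_comp.comp
        (hL.comp Computable.fst) (Computable.fst.comp Computable.snd)))
    · exact Primrec.or.to_comp.comp (Computable.snd.comp (Computable.snd.comp Computable.fst))
        Computable.snd
  refine ⟨_, Partrec.nat_rec (Computable.list_length.comp hL)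
    (Computable.const false).partrec hh, fun a ha => ?_⟩
  have key : ∀ n ≤ (L a).length, ∃ c ∈ (Nat.rec (motive := fun _ => Part Bool) (Part.some false)
      (fun m IH => IH.bind fun i => h a (m, i)) n : Part Bool),
      (c = true ↔ ∃ m, ∃ hm : m < (L a).length, m < n ∧ P (a, (L a)[m])) := by
    intro n hn
    induction n with
    | zero => exact ⟨false, Part.mem_some _, by simp⟩
    | succ n ih =>
      obtain ⟨c, hc, hc'⟩ := ih (by omega)
      have hn' : n < (L a).length := hn
      obtain ⟨d, hd, hd'⟩ := hfT (a, (L a)[n]) (hLT a ha _ (List.getElem_mem hn'))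
      refine ⟨c || d, Part.mem_bind hc (Part.mem_map_iff _ |>.2 ⟨d, ?_, rfl⟩), ?_⟩
      · rwa [List.getD_eq_getElem _ _ hn']
      · rw [Bool.or_eq_true, hc', hd']
        constructor
        · rintro (⟨m, hm, h1, h2⟩ | h2)
          · exact ⟨m, hm, by omega, h2⟩
          · exact ⟨n, hn', by omega, h2⟩
        · rintro ⟨m, hm, h1, h2⟩
          rcases Nat.lt_succ_iff_lt_or_eq.1 h1 with h1 | rfl
          · exact Or.inl ⟨m, hm, h1, h2⟩
          · exact Or.inr h2
  obtain ⟨c, hc, hc'⟩ := key _ le_rfl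
  refine ⟨c, hc, hc'.trans ⟨?_, ?_⟩⟩
  · rintro ⟨m, hm, -, h2⟩
    exact ⟨_, List.getElem_mem hm, h2⟩
  · rintro ⟨b, hb, h2⟩
    obtain ⟨m, hm, rfl⟩ := List.getElem_of_mem hb
    exact ⟨m, hm, hm, h2⟩

/-- Equivalence is decidable in a decidable fragment. -/
theorem DecidableFragment.equiv {F : Set FO} (hF : DecidableFragment F) :
    DecidableOn (F ×ˢ F) fun p : FO × FO => p.1.Entails p.2 ∧ p.2.Entails p.1 := by
  obtain ⟨f, hf, hfF⟩ := hF
  refine ⟨fun p => (f p).bind fun c => (f p.swap).map fun d => c && d, ?_, ?_⟩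
  · refine Partrec.bind hf (Partrec.map
      (f := fun t : (FO × FO) × Bool => f t.1.swap) (g := fun t d => t.2 && d) ?_ ?_)
    · exact hf.comp ((Computable.snd.comp Computable.fst).pair
        (Computable.fst.comp Computable.fst))
    · exact Primrec.and.to_comp.comp (Computable.snd.comp Computable.fst) Computable.snd
  · rintro p ⟨h1, h2⟩
    obtain ⟨c, hc, hc'⟩ := hfF p ⟨h1, h2⟩
    obtain ⟨d, hd, hd'⟩ := hfF p.swap ⟨h2, h1⟩
    exact ⟨c && d, Part.mem_bind hc (Part.mem_map_iff _ |>.2 ⟨d, hd, rfl⟩), by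
      rw [Bool.and_eq_true, hc', hd']; rfl⟩

/-- A computable list of standard translations that suffices for the definability of a formula. -/
def FO.candidates (x y : ℕ) (φ : FO) : List FO :=
  (FO.level x y (φ.encodeFO + 1) (depthBound (φ.encodeFO + 1) φ.encodeFO)).map Prod.fst

theorem FO.mem_candidates {x y : ℕ} {φ ψ : FO} : ψ ∈ FO.candidates x y φ ↔
    ∃ χ ∈ ML.level (φ.encodeFO + 1) (depthBound (φ.encodeFO + 1) φ.encodeFO), χ.st x y = ψ := by
  simp [FO.candidates, FO.level_eq, ML.stPair]

theorem FO.primrec_candidates (x y : ℕ) : Primrec (FO.candidates x y) := by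
  have he : Primrec FO.encodeFO := Primrec.encode
  exact Primrec.list_map ((FO.primrec_level x y).comp (Primrec.succ.comp he)
    (primrec_depthBound.comp he)) (Primrec.fst.comp Primrec.snd)

theorem mlDefinable_iff {x y : ℕ} (hxy : x ≠ y) (φ : FO) :
    MLDefinable x y φ ↔ ∃ ψ ∈ FO.candidates x y φ, φ.Entails ψ ∧ ψ.Entails φ := by
  constructor
  · intro h
    obtain ⟨χ, h1, h2⟩ := h.exists_mem_level hxy φ.qr_le_encodeFO
      (φ.unaryIn_encodeFO (Nat.lt_succ_self _))
    exact ⟨_, FO.mem_candidates.2 ⟨χ, h1, rfl⟩, h2⟩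
  · rintro ⟨ψ, h1, h2⟩
    obtain ⟨χ, -, rfl⟩ := FO.mem_candidates.1 h1
    exact ⟨χ, h2⟩

end ModalDefinability

theorem mainTheorem8 (x y : ℕ) (hxy : x ≠ y) (F : Set ModalDefinability.FO)
    (hF : ModalDefinability.DecidableFragment F) (hML : ModalDefinability.ContainsML F x y) :
    ModalDefinability.DecidableOn F (fun φ => ModalDefinability.MLDefinable x y φ) := by
  have : Inhabited ModalDefinability.FO := ⟨.top⟩
  obtain ⟨f, hf, hf'⟩ := hF.equiv.exists_mem
    -- Candidates are translations of modal formulas, so they lie in `F` and the equivalence test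
    -- applies to them.
    (ModalDefinability.FO.primrec_candidates x y).to_comp (S := F) (fun φ hφ ψ hψ => by
      obtain ⟨χ, -, rfl⟩ := ModalDefinability.FO.mem_candidates.1 hψ
      exact ⟨hφ, hML χ⟩)
  refine ⟨f, hf, fun φ hφ => ?_⟩
  obtain ⟨c, hc, hc'⟩ := hf' φ hφ
  exact ⟨c, hc, hc'.trans (ModalDefinability.mlDefinable_iff hxy φ).symm⟩
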